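/- **Definitions.** An *EDC-lattice* $\underline D=(D,C,\widehat C,\ll)$ is a bounded distributive lattice $(D,\le,0,1,+,\cdot)$ with binary relations $C$ (contact), $\widehat C$ (dual contact) and $\ll$ (nontangential part-of) such that, writing $\overline R$ for the complement of a relation $R$, for all elements: * (C1) $aCb\Rightarrow a,b\neq 0$; (C2) $aCb,\ a\le a',\ b\le b'\Rightarrow a'Cb'$; (C3) $aC(b+c)\Rightarrow aCb$ or $aCc$; (C4) $aCb\Rightarrow bCa$; (C5) $a\cdot b\ne 0\Rightarrow aCb$; * ($\widehat C$1) $a\widehat Cb\Rightarrow a,b\neq 1$; ($\widehat C$2) $a\widehat Cb,\ a'\le a,\ b'\le b\Rightarrow a'\widehat Cb'$; ($\widehat C$3) $a\widehat C(b\cdot c)\Rightarrow a\widehat Cb$ or $a\widehat Cc$; ($\widehat C$4) $a\widehat Cb\Rightarrow b\widehat Ca$; ($\widehat C$5) $a+b\ne 1\Rightarrow a\widehat Cb$; * ($\ll$1) $0\ll0$; ($\ll$2) $1\ll1$; ($\ll$3) $a\ll b\Rightarrow a\le b$; ($\ll$4) $a'\le a\ll b\le b'\Rightarrow a'\ll b'$;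 ($\ll$5) $a\ll c,\ b\ll c\Rightarrow (a+b)\ll c$; ($\ll$6) $c\ll a,\ c\ll b\Rightarrow c\ll (a\cdot b)$; ($\ll$7) $a\ll b,\ (b\cdot c)\ll d,\ c\ll(a+d)\Rightarrow c\ll d$; * (MC1) $aCb,\ a\ll c\Rightarrow aC(b\cdot c)$; (MC2) $a\overline C(b\cdot c),\ aCb,\ (a\cdot d)\overline Cb\Rightarrow d\widehat Cc$; (M$\widehat C$1) $a\widehat Cb,\ c\ll a\Rightarrow a\widehat C(b+c)$; (M$\widehat C$2) $a\overline{\widehat C}(b+c),\ a\widehat Cb,\ (a+d)\overline{\widehat C}b\Rightarrow dCc$; (M$\ll$1) $a\overline{\widehat C}b,\ (a\cdot c)\ll b\Rightarrow c\ll b$; (M$\ll$2) $a\overline Cb,\ b\ll(a+c)\Rightarrow b\ll c$. $\underline D$ is *O-rich* if (Ext O) $a\not\le b\Rightarrow\exists c\,(a\cdot c\ne0$ and $b\cdot c=0)$; (O-rich $\ll$) $a\ll b\Rightarrow\exists c\,(a\cdot c=0$ and $c\overline{\widehat C}b)$; (O-rich $C$) $a\overline Cb\Rightarrow\exists c,d\,(a\cdot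 c=0,\ b\cdot d=0$ and $c\overline{\widehat C}d)$. Further axioms: (Ext $\widehat C$) $a\neq0\Rightarrow(\exists b\neq1)\,a\overline{\widehat C}b$; (Con $\widehat C$) $a\ne1,\ b\neq1,\ a\cdot b=0\Rightarrow a\widehat Cb$; (Nor 2) $a\overline{\widehat C}b\Rightarrow\exists c,d\,(c\cdot d=0,\ a\overline{\widehat C}c,\ b\overline{\widehat C}d)$. For a topological space $X$, $RO(X)$ is the Boolean algebra of regular open sets ($a=\mathrm{Int}\,\mathrm{Cl}\,a$) with $a\cdot b=a\cap b$, $a+b=\mathrm{Int}\,\mathrm{Cl}(a\cup b)$, $a^*=\mathrm{Int}(X\smallsetminus a)$, with the contact $aCb\Leftrightarrow \mathrm{Cl}\,a\cap\mathrm{Cl}\,b\ne\varnothing$; it is an EDC-lattice with $a\widehat Cb\Leftrightarrow a^*Cb^*$ and $a\ll b\Leftrightarrow a\overline Cb^*$. An *embedding* $h$ of EDC-lattices is an injective homomorphism of bounded lattices that preserves and reflects $C,\widehat C,\ll$. An embedding $h:\underline D\to\underline E$ is *dense* if for every $a_2\ne0$ in $E$ there is $a_1\in D$ with $0\ne h(a_1)\le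 a_2$, and *$\widehat C$-separable* if for all $a_2,b_2\in E$: (1) if $a_2\overline Cb_2$, there are $a_1,b_1\in D$ with $h(a_1)\cdot a_2=0$, $h(b_1)\cdot b_2=0$, $h(a_1)\overline{\widehat C}h(b_1)$; (2) if $a_2\overline{\widehat C}b_2$, there are $a_1,b_1\in D$ with $h(a_1)\le a_2$, $h(b_1)\le b_2$, $h(a_1)\overline{\widehat C}h(b_1)$; (3) if $a_2\ll b_2$, there are $a_1,b_1\in D$ with $h(a_1)\cdot a_2=0$, $h(b_1)\le b_2$, $h(a_1)\overline{\widehat C}h(b_1)$. An *E-filter* of $\underline D$ is a proper filter $\Gamma\subseteq D$ such that $a,b\notin\Gamma$ implies $a\widehat Cb$. A space is *semiregular* if it has an open base of regular open sets; *weakly regular* if it is semiregular and every nonempty open set $a$ contains $\mathrm{Cl}(b)$ for some nonempty open $b$; *connected* if it is not the union of two disjoint nonempty open sets; *$\kappa$-normal* if any two disjoint regular closed sets can be separated by disjoint open sets. **Theorem.** Let $\underline D$ be an O-rich EDC-lattice and let $X$ be the set of all E-filters of $\underline D$, with the topology that has the sets $\{\Gamma\in X: a\in\Gamma\}$, $a\in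 D$, as an open base. Then $X$ is compact and semiregular, and $h(a)=\{\Gamma\in X: a\in\Gamma\}$ defines a dense and $\widehat C$-separable embedding $h$ of $\underline D$ into the contact algebra $RO(X)$. Moreover: (i) if $\underline D$ satisfies (Ext $\widehat C$), then $X$ is weakly regular; (ii) if $\underline D$ satisfies (Con $\widehat C$), then $X$ is connected; (iii) if $\underline D$ satisfies (Nor 2), then $X$ is $\kappa$-normal. -/

import Mathlib

open TopologicalSpace

/-- An extended distributive contact lattice: a bounded distributive lattice with relations of
contact `C`, dual contact `DC` (written `Ĉ` on paper) and nontangential part-of `NTP`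
(written `≪`). -/
class EDCLattice (D : Type*) [DistribLattice D] [BoundedOrder D] where
  C : D → D → Prop
  DC : D → D → Prop
  NTP : D → D → Prop
  C1 : ∀ a b, C a b → a ≠ ⊥ ∧ b ≠ ⊥
  C2 : ∀ a b a' b', C a b → a ≤ a' → b ≤ b' → C a' b'
  C3 : ∀ a b c, C a (b ⊔ c) → C a b ∨ C a c
  C4 : ∀ a b, C a b → C b a
  C5 : ∀ a b, a ⊓ b ≠ ⊥ → C a b
  DC1 : ∀ a b, DC a b → a ≠ ⊤ ∧ b ≠ ⊤
  DC2 : ∀ a b a' b', DC a b → a' ≤ a → b' ≤ b → DC a' b'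
  DC3 : ∀ a b c, DC a (b ⊓ c) → DC a b ∨ DC a c
  DC4 : ∀ a b, DC a b → DC b a
  DC5 : ∀ a b, a ⊔ b ≠ ⊤ → DC a b
  NTP1 : NTP ⊥ ⊥
  NTP2 : NTP ⊤ ⊤
  NTP3 : ∀ a b, NTP a b → a ≤ b
  NTP4 : ∀ a b a' b', a' ≤ a → NTP a b → b ≤ b' → NTP a' b'
  NTP5 : ∀ a b c, NTP a c → NTP b c → NTP (a ⊔ b) c
  NTP6 : ∀ a b c, NTP c a → NTP c b → NTP c (a ⊓ b)
  NTP7 : ∀ a b c d, NTP a b → NTP (b ⊓ c) d → NTP c (a ⊔ d) → NTP c d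
  MC1 : ∀ a b c, C a b → NTP a c → C a (b ⊓ c)
  MC2 : ∀ a b c d, ¬ C a (b ⊓ c) → C a b → ¬ C (a ⊓ d) b → DC d c
  MDC1 : ∀ a b c, DC a b → NTP c a → DC a (b ⊔ c)
  MDC2 : ∀ a b c d, ¬ DC a (b ⊔ c) → DC a b → ¬ DC (a ⊔ d) b → C d c
  MNTP1 : ∀ a b c, ¬ DC a b → NTP (a ⊓ c) b → NTP c b
  MNTP2 : ∀ a b c, ¬ C a b → NTP b (a ⊔ c) → NTP b c

/-- A contact algebra: a Boolean algebra with a contact relation. -/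
class ContactAlgebra (B : Type*) [BooleanAlgebra B] where
  contact : B → B → Prop
  contact1 : ∀ a b, contact a b → a ≠ ⊥ ∧ b ≠ ⊥
  contact2 : ∀ a b a' b', contact a b → a ≤ a' → b ≤ b' → contact a' b'
  contact3 : ∀ a b c, contact a (b ⊔ c) → contact a b ∨ contact a c
  contact4 : ∀ a b, contact a b → contact b a
  contact5 : ∀ a b, a ⊓ b ≠ ⊥ → contact a b

namespace ContactAlgebra

variable {B : Type*} [BooleanAlgebra B] [ContactAlgebra B]

theorem contact_split_right {a b : B} (c : B) (h : contact a b) :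
    contact a (b ⊓ c) ∨ contact a (b ⊓ cᶜ) := by
  apply contact3
  rwa [← inf_sup_left, sup_compl_eq_top, inf_top_eq]

theorem contact_split_left {a b : B} (c : B) (h : contact a b) :
    contact (a ⊓ c) b ∨ contact (a ⊓ cᶜ) b :=
  (contact_split_right c (contact4 _ _ h)).imp (contact4 _ _) (contact4 _ _)

theorem contact_mono {a b a' b' : B} (h : contact a b) (ha : a ≤ a') (hb : b ≤ b') :
    contact a' b' := contact2 _ _ _ _ h ha hb

/-- Every contact algebra is an EDC-lattice, with `a Ĉ b` defined as `aᶜ C bᶜ` and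
`a ≪ b` defined as the negation of `a C bᶜ`. -/
instance toEDCLattice : EDCLattice B where
  C := contact
  DC a b := contact aᶜ bᶜ
  NTP a b := ¬ contact a bᶜ
  C1 := contact1
  C2 := contact2
  C3 := contact3
  C4 := contact4
  C5 := contact5
  DC1 a b h := by simpa using contact1 _ _ h
  DC2 a b a' b' h ha hb := contact_mono h (compl_le_compl ha) (compl_le_compl hb)
  DC3 a b c h := contact3 _ _ _ (by rwa [compl_inf] at h)
  DC4 a b h := contact4 _ _ h
  DC5 a b h := contact5 _ _ (by rwa [← compl_sup, ne_eq, compl_eq_bot])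
  NTP1 h := (contact1 _ _ h).1 rfl
  NTP2 h := (contact1 _ _ h).2 compl_top
  NTP3 a b h := by
    by_contra hab
    exact h (contact5 _ _ fun h0 => hab (by rwa [← sdiff_eq, sdiff_eq_bot_iff] at h0))
  NTP4 a b a' b' ha h hb h' := h (contact_mono h' ha (compl_le_compl hb))
  NTP5 a b c h1 h2 h :=
    (contact3 _ _ _ (contact4 _ _ h)).elim (fun h => h1 (contact4 _ _ h))
      fun h => h2 (contact4 _ _ h)
  NTP6 a b c h1 h2 h := (contact3 _ _ _ (by rwa [compl_inf] at h)).elim h1 h2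
  NTP7 a b c d h1 h2 h3 h := by
    rcases contact_split_left b h with h | h
    · exact h2 (contact_mono h (le_of_eq (inf_comm _ _)) le_rfl)
    rcases contact_split_right a h with h | h
    · exact h1 (contact4 _ _ (contact_mono h inf_le_right inf_le_right))
    · exact h3 (contact_mono h inf_le_left (by rw [compl_sup, inf_comm]))
  MC1 a b c h h1 :=
    (contact_split_right c h).resolve_right fun h => h1 (contact_mono h le_rfl inf_le_right)
  MC2 a b c d h1 h h2 :=
    contact_mono
      ((contact_split_right c ((contact_split_left d h).resolve_left h2)).resolve_left
        fun h => h1 (contact_mono h inf_le_left le_rfl)) inf_le_right inf_le_right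
  MDC1 a b c h h1 := by
    rw [compl_sup]
    exact (contact_split_right c h).resolve_left
      fun h => h1 (contact4 _ _ (contact_mono h le_rfl inf_le_right))
  MDC2 a b c d h1 h h2 := by
    rw [compl_sup] at h1 h2
    exact contact_mono
      ((contact_split_right c ((contact_split_left d h).resolve_right h2)).resolve_right
        fun h => h1 (contact_mono h inf_le_left le_rfl)) inf_le_right inf_le_right
  MNTP1 a b c h1 h2 h :=
    (contact_split_left a h).elim (fun h => h2 (by rwa [inf_comm]))
      fun h => h1 (contact_mono h inf_le_right le_rfl)
  MNTP2 a b c h1 h2 h :=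
    (contact_split_right a h).elim
      (fun h => h1 (contact4 _ _ (contact_mono h le_rfl inf_le_right)))
      fun h => h2 (by rwa [compl_sup, inf_comm])

end ContactAlgebra

section RegularOpen

/-- A set is regular open if it is the interior of its closure. -/
def IsRegularOpenSet {X : Type*} [TopologicalSpace X] (s : Set X) : Prop :=
  interior (closure s) = s

/-- A set is regular closed if it is the closure of its interior. -/
def IsRegularClosedSet {X : Type*} [TopologicalSpace X] (s : Set X) : Prop :=
  closure (interior s) = s

/-- The Boolean algebra `RO(X)` of regular open subsets of `X`: the open sets `U` with
`Uᶜᶜ = U`, where `Uᶜ` is the interior of the set-theoretic complement of `U`. -/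
def RegOpens (X : Type*) [TopologicalSpace X] : Type _ := Heyting.Regular (Opens X)

instance (X : Type*) [TopologicalSpace X] : BooleanAlgebra (RegOpens X) :=
  inferInstanceAs (BooleanAlgebra (Heyting.Regular (Opens X)))

variable {X : Type*} [TopologicalSpace X]

/-- The underlying set of a regular open set. -/
def RegOpens.carrier (a : RegOpens X) : Set X :=
  ((Heyting.Regular.val a : Opens X) : Set X)

theorem Opens.coe_compl_compl (U : Opens X) :
    ((Uᶜᶜ : Opens X) : Set X) = interior (closure (U : Set X)) := by
  rw [Opens.coe_compl_eq_interior_compl, Opens.coe_compl_eq_interior_compl,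
    interior_compl (s := (U : Set X)), compl_compl]

theorem Opens.isRegular_iff (U : Opens X) :
    Heyting.IsRegular U ↔ IsRegularOpenSet (U : Set X) := by
  rw [Heyting.IsRegular, IsRegularOpenSet, ← Opens.coe_compl_compl, SetLike.coe_set_eq]

namespace RegOpens

theorem carrier_le {a b : RegOpens X} : a ≤ b ↔ a.carrier ⊆ b.carrier := Iff.rfl

theorem carrier_inf (a b : RegOpens X) : (a ⊓ b).carrier = a.carrier ∩ b.carrier := rfl

theorem carrier_sup (a b : RegOpens X) :
    (a ⊔ b).carrier = interior (closure (a.carrier ∪ b.carrier)) :=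
  Opens.coe_compl_compl _

theorem carrier_bot : (⊥ : RegOpens X).carrier = ∅ := rfl

theorem carrier_top : (⊤ : RegOpens X).carrier = Set.univ := rfl

theorem carrier_compl (a : RegOpens X) : (aᶜ).carrier = interior (a.carrier)ᶜ :=
  Opens.coe_compl_eq_interior_compl

theorem carrier_injective : Function.Injective (carrier : RegOpens X → Set X) :=
  SetLike.coe_injective.comp Heyting.Regular.coe_injective

/-- The contact algebra of regular open sets: two of them are in contact when their closures
meet. -/
instance : ContactAlgebra (RegOpens X) where
  contact a b := (closure a.carrier ∩ closure b.carrier).Nonempty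
  contact1 a b h := by
    constructor <;> rintro rfl <;> simp [carrier_bot] at h
  contact2 a b a' b' h ha hb :=
    h.mono (Set.inter_subset_inter (closure_mono ha) (closure_mono hb))
  contact3 a b c h := by
    obtain ⟨x, hxa, hx⟩ := h
    rw [carrier_sup] at hx
    have hx' := closure_minimal interior_subset isClosed_closure hx
    rw [closure_union] at hx'
    exact hx'.imp (fun h => ⟨x, hxa, h⟩) fun h => ⟨x, hxa, h⟩
  contact4 a b h := by rwa [Set.inter_comm]
  contact5 a b h := by
    rw [ne_eq, ← carrier_injective.eq_iff, carrier_inf, carrier_bot, ← ne_eq,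
      ← Set.nonempty_iff_ne_empty] at h
    exact h.mono (Set.inter_subset_inter subset_closure subset_closure)

end RegOpens

/-- A semiregular space: the topology has an open base consisting of regular open sets. -/
def SemiregularSpace (X : Type*) [TopologicalSpace X] : Prop :=
  ∃ B : Set (Set X), IsTopologicalBasis B ∧ ∀ s ∈ B, IsRegularOpenSet s

/-- A weakly regular space: semiregular, and every nonempty open set contains the closure of
some nonempty open set. -/
def WeaklyRegularSpace (X : Type*) [TopologicalSpace X] : Prop :=
  SemiregularSpace X ∧
    ∀ a : Set X, IsOpen a → a.Nonempty → ∃ b : Set X, IsOpen b ∧ b.Nonempty ∧ closure b ⊆ a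

/-- A `κ`-normal space: disjoint regular closed sets have disjoint open neighbourhoods. -/
def KappaNormalSpace (X : Type*) [TopologicalSpace X] : Prop :=
  ∀ F G : Set X, IsRegularClosedSet F → IsRegularClosedSet G → Disjoint F G →
    SeparatedNhds F G

end RegularOpen

namespace EDCLattice

variable (D : Type*) [DistribLattice D] [BoundedOrder D] [EDCLattice D]

/-- (Ext O): extensionality of overlap. -/
def ExtO : Prop := ∀ a b : D, ¬ a ≤ b → ∃ c, a ⊓ c ≠ ⊥ ∧ b ⊓ c = ⊥

/-- (O-rich `≪`). -/
def ORichNTP : Prop := ∀ a b : D, NTP a b → ∃ c, a ⊓ c = ⊥ ∧ ¬ DC c b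

/-- (O-rich `C`). -/
def ORichC : Prop := ∀ a b : D, ¬ C a b → ∃ c d, a ⊓ c = ⊥ ∧ b ⊓ d = ⊥ ∧ ¬ DC c d

/-- O-rich EDC-lattices. -/
structure IsORich : Prop where
  extO : ExtO D
  oRichNTP : ORichNTP D
  oRichC : ORichC D

/-- (Ext `Ĉ`): extensionality of dual contact. -/
def ExtDC : Prop := ∀ a : D, a ≠ ⊥ → ∃ b, b ≠ ⊤ ∧ ¬ DC a b

/-- (Con `Ĉ`): connectedness for dual contact. -/
def ConDC : Prop := ∀ a b : D, a ≠ ⊤ → b ≠ ⊤ → a ⊓ b = ⊥ → DC a b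

/-- (Nor 2): normality for dual contact. -/
def Nor2 : Prop := ∀ a b : D, ¬ DC a b → ∃ c d, c ⊓ d = ⊥ ∧ ¬ DC a c ∧ ¬ DC b d

variable {D} {E : Type*} [DistribLattice E] [BoundedOrder E] [EDCLattice E]

/-- A homomorphism of bounded lattices is an embedding of EDC-lattices if it is injective and
the three relations of `D` are the restrictions of those of `E`. -/
structure IsEmbedding (h : BoundedLatticeHom D E) : Prop where
  injective : Function.Injective h
  map_C : ∀ a b, C (h a) (h b) ↔ C a b
  map_DC : ∀ a b, DC (h a) (h b) ↔ DC a b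
  map_NTP : ∀ a b, NTP (h a) (h b) ↔ NTP a b

/-- The image of `h` is a dense sublattice. -/
def IsDense (h : BoundedLatticeHom D E) : Prop :=
  ∀ a₂ : E, a₂ ≠ ⊥ → ∃ a₁ : D, h a₁ ≤ a₂ ∧ h a₁ ≠ ⊥

/-- The image of `h` is a `Ĉ`-separable EDC-sublattice. -/
structure IsDCSeparable (h : BoundedLatticeHom D E) : Prop where
  sep_C : ∀ a₂ b₂ : E, ¬ C a₂ b₂ →
    ∃ a₁ b₁ : D, h a₁ ⊓ a₂ = ⊥ ∧ h b₁ ⊓ b₂ = ⊥ ∧ ¬ DC (h a₁) (h b₁)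
  sep_DC : ∀ a₂ b₂ : E, ¬ DC a₂ b₂ →
    ∃ a₁ b₁ : D, h a₁ ≤ a₂ ∧ h b₁ ≤ b₂ ∧ ¬ DC (h a₁) (h b₁)
  sep_NTP : ∀ a₂ b₂ : E, NTP a₂ b₂ →
    ∃ a₁ b₁ : D, h a₁ ⊓ a₂ = ⊥ ∧ h b₁ ≤ b₂ ∧ ¬ DC (h a₁) (h b₁)

end EDCLattice

/-- An E-filter of an EDC-lattice: a proper filter such that any two elements outside it are
in dual contact. -/
structure EFilter (D : Type*) [DistribLattice D] [BoundedOrder D] [EDCLattice D] where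
  carrier : Set D
  top_mem : ⊤ ∈ carrier
  mem_of_le : ∀ a b, a ∈ carrier → a ≤ b → b ∈ carrier
  inf_mem : ∀ a b, a ∈ carrier → b ∈ carrier → a ⊓ b ∈ carrier
  bot_notMem : ⊥ ∉ carrier
  dc_of_notMem : ∀ a b, a ∉ carrier → b ∉ carrier → EDCLattice.DC a b

namespace EFilter

variable {D : Type*} [DistribLattice D] [BoundedOrder D] [EDCLattice D]

/-- The set of all E-filters that contain `a`. -/
def basicSet (a : D) : Set (EFilter D) := {Γ | a ∈ Γ.carrier}

/-- The topology on the set of E-filters with the sets `basicSet a` as an open base. -/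
instance : TopologicalSpace (EFilter D) := generateFrom (Set.range basicSet)

theorem isTopologicalBasis_basicSet :
    IsTopologicalBasis (Set.range (basicSet : D → Set (EFilter D))) where
  exists_subset_inter := by
    rintro _ ⟨a, rfl⟩ _ ⟨b, rfl⟩ Γ ⟨ha, hb⟩
    exact ⟨_, ⟨a ⊓ b, rfl⟩, Γ.inf_mem _ _ ha hb, fun Δ h =>
      ⟨Δ.mem_of_le _ _ h inf_le_left, Δ.mem_of_le _ _ h inf_le_right⟩⟩
  sUnion_eq := Set.eq_univ_of_forall fun Γ => ⟨_, ⟨⊤, rfl⟩, Γ.top_mem⟩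
  eq_generateFrom := rfl

end EFilter

/-! Points of the space come from pairs of prime ideals. If all elements of an ideal I are in dual
contact with all elements of an ideal J, both enlarge to prime ideals with the same property, and
the elements outside both form an E-filter (`exists_forall_notMem`). Principal ideals show that a Ĉ
b holds exactly when the basic sets of a and b fail to cover the space. Ideals of elements disjoint
from a given one describe closures; with (MC2) and (M≪1) they supply the points needed for C and ≪,
while the O-rich axioms give the converses. (Ext O) makes basic sets regular open. By compactness,
two regular open sets covering the space contain basic sets that cover it
(`exists_basicSet_subset_of_cover`). Since Ĉ, C and ≪ in RO(X) all say whether two regular open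
sets, possibly complemented, cover X, this yields Ĉ-separability, and it transfers (Con Ĉ) and (Nor
2) to the space. -/

open Order in
/-- An ideal all of whose elements are in dual contact with those of a given ideal extends to a
prime ideal with the same property. -/
theorem EDCLattice.exists_isPrime_forall_dc {D : Type*} [DistribLattice D] [BoundedOrder D]
    [EDCLattice D] (I J : Ideal D) (h : ∀ x ∈ I, ∀ y ∈ J, EDCLattice.DC x y) :
    ∃ P : Ideal D, P.IsPrime ∧ I ≤ P ∧ ∀ x ∈ P, ∀ y ∈ J, EDCLattice.DC x y := by
  -- The elements not in dual contact with some member of J form a filter, by (Ĉ3); a prime ideal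
  -- containing I and missing this filter is what is wanted.
  have hF : IsPFilter {x : D | ∃ y ∈ J, ¬ EDCLattice.DC x y} := by
    refine IsPFilter.of_def ?_ ?_ ?_
    · exact ⟨⊤, ⊥, J.bot_mem, fun h => (EDCLattice.DC1 _ _ h).1 rfl⟩
    · rintro x ⟨y, hy, hxy⟩ x' ⟨y', hy', hxy'⟩
      refine ⟨x ⊓ x', ⟨y ⊔ y', Ideal.sup_mem hy hy', fun hd => ?_⟩, inf_le_left, inf_le_right⟩
      rcases EDCLattice.DC3 _ _ _ (EDCLattice.DC4 _ _ hd) with hd | hd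
      · exact hxy (EDCLattice.DC2 _ _ _ _ (EDCLattice.DC4 _ _ hd) le_rfl le_sup_left)
      · exact hxy' (EDCLattice.DC2 _ _ _ _ (EDCLattice.DC4 _ _ hd) le_rfl le_sup_right)
    · rintro x x' hx ⟨y, hy, hxy⟩
      exact ⟨y, hy, fun hd => hxy (EDCLattice.DC2 _ _ _ _ hd hx le_rfl)⟩
  obtain ⟨P, hP, hIP, hFP⟩ := DistribLattice.prime_ideal_of_disjoint_filter_ideal
    (F := hF.toPFilter) (I := I)
    (Set.disjoint_left.2 fun x ⟨y, hy, hxy⟩ hx => hxy (h x hx y hy))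
  refine ⟨P, hP, hIP, fun x hx y hy => ?_⟩
  by_contra hxy
  exact Set.disjoint_left.1 hFP (show x ∈ {x : D | ∃ y ∈ J, ¬ EDCLattice.DC x y} from
    ⟨y, hy, hxy⟩) hx

/-! ### The relations of RO(X) in terms of points. -/

namespace RegOpens

variable {X : Type*} [TopologicalSpace X]

/-- The element of `RO(X)` given by a regular open set. -/
def ofSet (s : Set X) (hs : IsRegularOpenSet s) : RegOpens X :=
  ⟨⟨s, by rw [← show interior (closure s) = s from hs]; exact isOpen_interior⟩,
    (Opens.isRegular_iff _).2 hs⟩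

theorem isOpen_carrier (a : RegOpens X) : IsOpen a.carrier :=
  (Heyting.Regular.val a : Opens X).isOpen

theorem isRegularOpenSet_carrier (a : RegOpens X) : IsRegularOpenSet a.carrier :=
  (Opens.isRegular_iff _).1 a.2

theorem carrier_nonempty {a : RegOpens X} (ha : a ≠ ⊥) : a.carrier.Nonempty := by
  rw [Set.nonempty_iff_ne_empty]
  exact fun h => ha (carrier_injective h)

theorem closure_carrier_compl (a : RegOpens X) : closure (aᶜ).carrier = a.carrierᶜ := by
  rw [carrier_compl, interior_compl, closure_compl]
  exact congrArg _ a.isRegularOpenSet_carrier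

theorem dc_iff (a b : RegOpens X) :
    EDCLattice.DC a b ↔ ∃ x, x ∉ a.carrier ∧ x ∉ b.carrier := by
  change (closure (aᶜ).carrier ∩ closure (bᶜ).carrier).Nonempty ↔ _
  rw [closure_carrier_compl, closure_carrier_compl]
  rfl

theorem ntp_iff (a b : RegOpens X) :
    EDCLattice.NTP a b ↔ closure a.carrier ⊆ b.carrier := by
  change ¬ (closure a.carrier ∩ closure (bᶜ).carrier).Nonempty ↔ _
  rw [closure_carrier_compl, Set.inter_compl_nonempty_iff, not_not]

end RegOpens

theorem IsClopen.isRegularOpenSet {X : Type*} [TopologicalSpace X] {s : Set X}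
    (hs : IsClopen s) : IsRegularOpenSet s := by
  rw [IsRegularOpenSet, hs.isClosed.closure_eq, hs.isOpen.interior_eq]

theorem IsRegularClosedSet.compl {X : Type*} [TopologicalSpace X] {s : Set X}
    (hs : IsRegularClosedSet s) : IsRegularOpenSet sᶜ := by
  rw [IsRegularOpenSet, closure_compl, interior_compl]
  exact congrArg _ hs

/-! ### E-filters, basic sets and compactness. -/

namespace EFilter

open EDCLattice

variable {D : Type*} [DistribLattice D] [BoundedOrder D] [EDCLattice D]

theorem isOpen_basicSet (a : D) : IsOpen (basicSet a) :=
  isTopologicalBasis_basicSet.isOpen ⟨a, rfl⟩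

/-- Two ideals with all elements of one in dual contact with all elements of the other are
avoided by a common E-filter. -/
theorem exists_forall_notMem (I J : Order.Ideal D) (h : ∀ x ∈ I, ∀ y ∈ J, DC x y) :
    ∃ Γ : EFilter D, (∀ x ∈ I, x ∉ Γ.carrier) ∧ ∀ y ∈ J, y ∉ Γ.carrier := by
  obtain ⟨P, hP, hIP, h⟩ := exists_isPrime_forall_dc I J h
  obtain ⟨Q, hQ, hJQ, h⟩ :=
    exists_isPrime_forall_dc J P fun y hy x hx => DC4 _ _ (h x hx y hy)
  -- Inside one proper ideal a join is never ⊤, so (Ĉ5) applies.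
  have hdc : ∀ R : Order.Ideal D, R.IsPrime → ∀ x ∈ R, ∀ y ∈ R, DC x y := fun R hR x hx y hy =>
    DC5 _ _ fun hxy => hR.toIsProper.top_notMem (hxy ▸ Order.Ideal.sup_mem hx hy)
  refine ⟨{
    carrier := {x | x ∉ P ∧ x ∉ Q}
    top_mem := ⟨hP.toIsProper.top_notMem, hQ.toIsProper.top_notMem⟩
    mem_of_le := fun a b ha hab => ⟨fun hb => ha.1 (P.lower hab hb), fun hb => ha.2 (Q.lower hab hb)⟩
    inf_mem := fun a b ha hb => ⟨fun hab => (hP.mem_or_mem hab).elim ha.1 hb.1,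
      fun hab => (hQ.mem_or_mem hab).elim ha.2 hb.2⟩
    bot_notMem := fun hb => hb.1 P.bot_mem
    dc_of_notMem := fun a b ha hb => ?_ }, fun x hx hx' => hx'.1 (hIP hx),
    fun y hy hy' => hy'.2 (hJQ hy)⟩
  simp only [Set.mem_ofPred_eq, not_and_or, not_not] at ha hb
  rcases ha with ha | ha <;> rcases hb with hb | hb
  · exact hdc P hP _ ha _ hb
  · exact DC4 _ _ (h _ hb _ ha)
  · exact h _ ha _ hb
  · exact hdc Q hQ _ ha _ hb

/-- The ideal of all elements disjoint from `a`. -/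
def disjointIdeal (a : D) : Order.Ideal D where
  carrier := {x | a ⊓ x = ⊥}
  lower' x y hyx hx := le_bot_iff.1 ((inf_le_inf_left a hyx).trans (le_of_eq hx))
  nonempty' := ⟨⊥, inf_bot_eq a⟩
  directed' x hx y hy := ⟨x ⊔ y, by
    change a ⊓ (x ⊔ y) = ⊥
    rw [inf_sup_left, show a ⊓ x = ⊥ from hx, show a ⊓ y = ⊥ from hy, bot_sup_eq],
    le_sup_left, le_sup_right⟩

theorem exists_notMem_notMem_iff (a b : D) :
    (∃ Γ : EFilter D, a ∉ Γ.carrier ∧ b ∉ Γ.carrier) ↔ DC a b := by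
  refine ⟨fun ⟨Γ, ha, hb⟩ => Γ.dc_of_notMem _ _ ha hb, fun h => ?_⟩
  obtain ⟨Γ, h1, h2⟩ := exists_forall_notMem (Order.Ideal.principal a) (Order.Ideal.principal b)
    fun x hx y hy => DC2 _ _ _ _ h hx hy
  exact ⟨Γ, h1 a le_rfl, h2 b le_rfl⟩

open Order in
-- The complement of a prime ideal is already an E-filter by (Ĉ5), so prime filters separate
-- elements.
theorem basicSet_subset_iff {a b : D} : basicSet a ⊆ basicSet b ↔ a ≤ b := by
  refine ⟨fun h => ?_, fun h Γ hΓ => Γ.mem_of_le _ _ hΓ h⟩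
  by_contra hab
  obtain ⟨P, hP, hbP, haP⟩ := DistribLattice.prime_ideal_of_disjoint_filter_ideal
    (F := PFilter.principal a) (I := Ideal.principal b)
    (Set.disjoint_left.2 fun x hx hx' => hab (le_trans (PFilter.mem_principal.1 hx) hx'))
  let Γ : EFilter D :=
    { carrier := {x | x ∉ P}
      top_mem := hP.toIsProper.top_notMem
      mem_of_le := fun x y hx hxy hy => hx (P.lower hxy hy)
      inf_mem := fun x y hx hy hxy => (hP.mem_or_mem hxy).elim hx hy
      bot_notMem := fun hb => hb P.bot_mem
      dc_of_notMem := fun x y hx hy => DC5 _ _ fun hxy =>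
        hP.toIsProper.top_notMem (hxy ▸ Ideal.sup_mem (not_not.1 hx) (not_not.1 hy)) }
  have haΓ : Γ ∈ basicSet a := fun ha =>
    Set.disjoint_left.1 haP (PFilter.mem_principal.2 le_rfl) ha
  exact h haΓ (hbP le_rfl)

theorem basicSet_bot : basicSet (⊥ : D) = ∅ := Set.eq_empty_of_forall_notMem fun Γ => Γ.bot_notMem

theorem basicSet_top : basicSet (⊤ : D) = Set.univ := Set.eq_univ_of_forall fun Γ => Γ.top_mem

theorem basicSet_inf (a b : D) : basicSet (a ⊓ b) = basicSet a ∩ basicSet b :=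
  Set.ext fun Γ => ⟨fun h => ⟨Γ.mem_of_le _ _ h inf_le_left, Γ.mem_of_le _ _ h inf_le_right⟩,
    fun h => Γ.inf_mem _ _ h.1 h.2⟩

theorem basicSet_nonempty_iff {a : D} : (basicSet a).Nonempty ↔ a ≠ ⊥ := by
  rw [Set.nonempty_iff_ne_empty, ne_eq, ne_eq, ← Set.subset_empty_iff, ← basicSet_bot (D := D),
    basicSet_subset_iff, le_bot_iff]

theorem mem_closure_iff {Γ : EFilter D} {s : Set (EFilter D)} :
    Γ ∈ closure s ↔ ∀ c ∈ Γ.carrier, (basicSet c ∩ s).Nonempty := by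
  rw [isTopologicalBasis_basicSet.mem_closure_iff, Set.forall_mem_range]
  rfl

/-- Lying in this closure means avoiding `disjointIdeal a`, which is how `exists_forall_notMem`
yields points of closures. -/
theorem mem_closure_basicSet_iff {Γ : EFilter D} {a : D} :
    Γ ∈ closure (basicSet a) ↔ ∀ c ∈ Γ.carrier, a ⊓ c ≠ ⊥ := by
  simp only [mem_closure_iff, ← basicSet_inf, basicSet_nonempty_iff, inf_comm a]

theorem exists_basicSet_subset {Γ : EFilter D} {U : Set (EFilter D)} (hU : IsOpen U)
    (hΓ : Γ ∈ U) : ∃ a ∈ Γ.carrier, basicSet a ⊆ U := by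
  obtain ⟨_, ⟨a, rfl⟩, ha, haU⟩ := isTopologicalBasis_basicSet.exists_subset_of_mem_open hΓ hU
  exact ⟨a, ha, haU⟩

instance : CompactSpace (EFilter D) := by
  refine ⟨isCompact_iff_ultrafilter_le_nhds.2 fun F _ => ?_⟩
  -- The limit of F: if neither basic set belongs to F, both complements do, so some point avoids
  -- both elements.
  let Γ : EFilter D :=
    { carrier := {a | basicSet a ∈ F}
      top_mem := by
        change basicSet (⊤ : D) ∈ F
        rw [basicSet_top]
        exact Filter.univ_mem
      mem_of_le := fun a b ha hab => Filter.mem_of_superset ha (basicSet_subset_iff.2 hab)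
      inf_mem := fun a b ha hb => by
        change basicSet (a ⊓ b) ∈ F
        rw [basicSet_inf]
        exact Filter.inter_mem ha hb
      bot_notMem := fun h => F.empty_notMem (basicSet_bot (D := D) ▸ h)
      dc_of_notMem := fun a b ha hb => by
        obtain ⟨Δ, ha, hb⟩ := F.nonempty_of_mem
          (Filter.inter_mem (Ultrafilter.compl_mem_iff_notMem.2 ha)
            (Ultrafilter.compl_mem_iff_notMem.2 hb))
        exact Δ.dc_of_notMem _ _ ha hb }
  refine ⟨Γ, Set.mem_univ _, ?_⟩
  refine isTopologicalBasis_basicSet.nhds_hasBasis.ge_iff.2 ?_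
  rintro _ ⟨⟨a, rfl⟩, ha⟩
  exact ha

/-! ### Regularity of basic sets and the embedding into RO(X). -/

theorem isRegularOpenSet_basicSet (hD : ExtO D) (a : D) :
    IsRegularOpenSet (basicSet a) := by
  refine subset_antisymm (fun Γ hΓ => ?_) (interior_maximal subset_closure (isOpen_basicSet a))
  obtain ⟨c, hc, hca⟩ := exists_basicSet_subset isOpen_interior hΓ
  refine Γ.mem_of_le _ _ hc ?_
  by_contra h
  -- A point containing c and e lies in the closure of `basicSet a`, yet `basicSet e` is a
  -- neighbourhood of it missing `basicSet a`.
  obtain ⟨e, hce, hae⟩ := hD c a h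
  obtain ⟨Δ, hΔ⟩ := basicSet_nonempty_iff.2 hce
  rw [basicSet_inf] at hΔ
  exact mem_closure_basicSet_iff.1 (interior_subset (hca hΔ.1)) e hΔ.2 hae

/-- E-filters need not be prime, so the bare union may be too small. If c, d in Γ are disjoint from
a, b respectively, then a ⊔ b is disjoint from c ⊓ d. -/
theorem basicSet_sup (hD : ExtO D) (a b : D) :
    basicSet (a ⊔ b) = interior (closure (basicSet a ∪ basicSet b)) := by
  apply subset_antisymm
  · refine interior_maximal (fun Γ hΓ => ?_) (isOpen_basicSet _)
    rw [closure_union, Set.mem_union, mem_closure_basicSet_iff, mem_closure_basicSet_iff]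
    by_contra! ⟨⟨c, hc, hac⟩, d, hd, hbd⟩
    refine Γ.bot_notMem (Γ.mem_of_le _ _ (Γ.inf_mem _ _ hΓ (Γ.inf_mem _ _ hc hd)) ?_)
    rw [inf_sup_right, ← inf_assoc, hac, inf_left_comm, hbd, bot_inf_eq, inf_bot_eq, bot_sup_eq]
  · refine (interior_mono (closure_mono (Set.union_subset ?_ ?_))).trans
      (isRegularOpenSet_basicSet hD (a ⊔ b)).subset
    · exact basicSet_subset_iff.2 le_sup_left
    · exact basicSet_subset_iff.2 le_sup_right

/-- The homomorphism from an EDC-lattice to the regular open sets of its space of E-filters. -/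
def toRegOpens (hD : ExtO D) : BoundedLatticeHom D (RegOpens (EFilter D)) where
  toFun a := RegOpens.ofSet (basicSet a) (isRegularOpenSet_basicSet hD a)
  map_sup' a b := RegOpens.carrier_injective <| by
    rw [RegOpens.carrier_sup]
    exact basicSet_sup hD a b
  map_inf' a b := RegOpens.carrier_injective <| by
    rw [RegOpens.carrier_inf]
    exact basicSet_inf a b
  map_top' := RegOpens.carrier_injective (basicSet_top.trans RegOpens.carrier_top.symm)
  map_bot' := RegOpens.carrier_injective (basicSet_bot.trans RegOpens.carrier_bot.symm)

theorem carrier_toRegOpens (hD : ExtO D) (a : D) :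
    (toRegOpens hD a).carrier = basicSet a := rfl

theorem c_iff_exists_mem_closure (hD : ORichC D) (a b : D) :
    C a b ↔ ∃ Γ : EFilter D, Γ ∈ closure (basicSet a) ∧ Γ ∈ closure (basicSet b) := by
  simp only [mem_closure_basicSet_iff]
  constructor
  · intro h
    obtain ⟨Γ, h1, h2⟩ := exists_forall_notMem (disjointIdeal a) (disjointIdeal b)
      -- With a ⊓ x = ⊥ and b ⊓ y = ⊥, both non-contacts required by (MC2) hold by (C1).
      fun x hx y hy => MC2 a b y x (fun h' => (C1 _ _ h').2 hy) h fun h' => (C1 _ _ h').1 hx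
    exact ⟨Γ, fun c hc hac => h1 c hac hc, fun c hc hbc => h2 c hbc hc⟩
  · rintro ⟨Γ, ha, hb⟩
    by_contra h
    obtain ⟨c, d, hac, hbd, hcd⟩ := hD a b h
    exact hcd (Γ.dc_of_notMem _ _ (fun hc => ha c hc hac) fun hd => hb d hd hbd)

theorem ntp_iff_closure_subset (hD : ORichNTP D) (a b : D) :
    NTP a b ↔ closure (basicSet a) ⊆ basicSet b := by
  constructor
  · intro h Γ hΓ
    obtain ⟨c, hac, hcb⟩ := hD a b h
    by_contra hb
    exact hcb (Γ.dc_of_notMem _ _ (fun hc => mem_closure_basicSet_iff.1 hΓ c hc hac) hb)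
  · intro h
    by_contra hab
    obtain ⟨Γ, h1, h2⟩ := exists_forall_notMem (disjointIdeal a) (Order.Ideal.principal b) <| by
      intro x hx y hy
      by_contra hxy
      -- Here x ⊓ a = ⊥ ≪ ⊥ ≤ b, so (M≪1) cancels x.
      refine hab (MNTP1 x b a (fun h' => hxy (DC2 _ _ _ _ h' le_rfl hy)) ?_)
      exact NTP4 _ _ _ _ (by rw [inf_comm]; exact le_of_eq hx) NTP1 bot_le
    exact h2 b le_rfl (h (mem_closure_basicSet_iff.2 fun c hc hac => h1 c hac hc))

theorem isEmbedding_toRegOpens (hD : IsORich D) : IsEmbedding (toRegOpens hD.extO) where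
  injective a b h := by
    have h' : basicSet a = basicSet b := congrArg RegOpens.carrier h
    exact le_antisymm (basicSet_subset_iff.1 h'.subset) (basicSet_subset_iff.1 h'.superset)
  map_C a b := (c_iff_exists_mem_closure hD.oRichC a b).symm
  map_DC a b := (RegOpens.dc_iff _ _).trans (exists_notMem_notMem_iff a b)
  map_NTP a b := (RegOpens.ntp_iff _ _).trans (ntp_iff_closure_subset hD.oRichNTP a b).symm

theorem isDense_toRegOpens (hD : ExtO D) : IsDense (toRegOpens hD) := by
  intro U hU
  obtain ⟨Γ, hΓ⟩ := RegOpens.carrier_nonempty hU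
  obtain ⟨a, ha, haU⟩ := exists_basicSet_subset U.isOpen_carrier hΓ
  refine ⟨a, haU, fun h => ?_⟩
  have h' : basicSet a = ∅ := congrArg RegOpens.carrier h
  exact (h' ▸ ha : Γ ∈ (∅ : Set (EFilter D)))

/-! ### Covers by regular open sets and separability. -/

/-- Two regular open sets that cover the space of E-filters contain basic sets that cover it. -/
theorem exists_basicSet_subset_of_cover (hD : ExtO D) {U V : Set (EFilter D)}
    (hU : IsRegularOpenSet U) (hV : IsRegularOpenSet V) (hUV : ∀ Γ, Γ ∈ U ∨ Γ ∈ V) :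
    ∃ a b : D, basicSet a ⊆ U ∧ basicSet b ⊆ V ∧ ¬ DC a b := by
  have hopen : ∀ {W : Set (EFilter D)}, IsRegularOpenSet W → IsOpen W := fun {W} hW => by
    rw [← show interior (closure W) = W from hW]
    exact isOpen_interior
  -- Regularity of W keeps joins inside W, so one basic set on each side suffices at every stage of
  -- the compactness induction.
  have hsup : ∀ {W : Set (EFilter D)}, IsRegularOpenSet W → ∀ a b : D, basicSet a ⊆ W →
      basicSet b ⊆ W → basicSet (a ⊔ b) ⊆ W := fun {W} hW a b ha hb => by
    rw [basicSet_sup hD]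
    exact (interior_mono (closure_mono (Set.union_subset ha hb))).trans hW.subset
  obtain ⟨a, b, ha, hb, hab⟩ : ∃ a b : D, basicSet a ⊆ U ∧ basicSet b ⊆ V ∧
      (Set.univ : Set (EFilter D)) ⊆ basicSet a ∪ basicSet b := by
    refine isCompact_univ.induction_on (p := fun s => ∃ a b : D, basicSet a ⊆ U ∧
      basicSet b ⊆ V ∧ s ⊆ basicSet a ∪ basicSet b) ?_ ?_ ?_ ?_
    · exact ⟨⊥, ⊥, by simp [basicSet_bot], by simp [basicSet_bot], Set.empty_subset _⟩
    · rintro s t hst ⟨a, b, ha, hb, h⟩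
      exact ⟨a, b, ha, hb, hst.trans h⟩
    · rintro s t ⟨a, b, ha, hb, h⟩ ⟨a', b', ha', hb', h'⟩
      refine ⟨a ⊔ a', b ⊔ b', hsup hU _ _ ha ha', hsup hV _ _ hb hb', Set.union_subset ?_ ?_⟩
      · exact h.trans (Set.union_subset_union (basicSet_subset_iff.2 le_sup_left)
          (basicSet_subset_iff.2 le_sup_left))
      · exact h'.trans (Set.union_subset_union (basicSet_subset_iff.2 le_sup_right)
          (basicSet_subset_iff.2 le_sup_right))
    · intro Γ _
      rcases hUV Γ with h | h
      · obtain ⟨a, ha, haU⟩ := exists_basicSet_subset (hopen hU) h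
        exact ⟨basicSet a, mem_nhdsWithin_of_mem_nhds ((isOpen_basicSet a).mem_nhds ha), a, ⊥, haU,
          by simp [basicSet_bot], Set.subset_union_left⟩
      · obtain ⟨a, ha, haV⟩ := exists_basicSet_subset (hopen hV) h
        exact ⟨basicSet a, mem_nhdsWithin_of_mem_nhds ((isOpen_basicSet a).mem_nhds ha), ⊥, a,
          by simp [basicSet_bot], haV, Set.subset_union_right⟩
  refine ⟨a, b, ha, hb, fun h => ?_⟩
  obtain ⟨Γ, h1, h2⟩ := (exists_notMem_notMem_iff a b).2 h
  exact (hab (Set.mem_univ Γ)).elim h1 h2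

theorem mem_or_mem_of_not_dc {a b : D} (h : ¬ DC a b) (Γ : EFilter D) :
    a ∈ Γ.carrier ∨ b ∈ Γ.carrier := by
  by_contra! hΓ
  exact h (Γ.dc_of_notMem _ _ hΓ.1 hΓ.2)

theorem isDCSeparable_toRegOpens (hD : IsORich D) : IsDCSeparable (toRegOpens hD.extO) := by
  have key : ∀ U V : RegOpens (EFilter D), ¬ DC U V → ∃ a b : D,
      toRegOpens hD.extO a ≤ U ∧ toRegOpens hD.extO b ≤ V ∧
        ¬ DC (toRegOpens hD.extO a) (toRegOpens hD.extO b) := by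
    intro U V h
    obtain ⟨a, b, ha, hb, hab⟩ := exists_basicSet_subset_of_cover hD.extO
      U.isRegularOpenSet_carrier V.isRegularOpenSet_carrier fun Γ => by
        by_contra! hΓ
        exact h ((RegOpens.dc_iff _ _).2 ⟨Γ, hΓ⟩)
    exact ⟨a, b, ha, hb, fun h => hab (((isEmbedding_toRegOpens hD).map_DC a b).1 h)⟩
  have hdisj : ∀ {U V : RegOpens (EFilter D)}, U ≤ Vᶜ → U ⊓ V = ⊥ := fun h =>
    (le_compl_iff_disjoint_right.1 h).eq_bot
  refine ⟨fun U V h => ?_, key, fun U V h => ?_⟩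
  -- U and V are not in contact exactly when their complements are not in dual contact.
  · obtain ⟨a, b, ha, hb, hab⟩ := key Uᶜ Vᶜ fun h' => h <| by
      change ContactAlgebra.contact Uᶜᶜ Vᶜᶜ at h'
      rwa [compl_compl, compl_compl] at h'
    exact ⟨a, b, hdisj ha, hdisj hb, hab⟩
  · obtain ⟨a, b, ha, hb, hab⟩ := key Uᶜ V fun h' => h <| by
      change ContactAlgebra.contact Uᶜᶜ Vᶜ at h'
      rwa [compl_compl] at h'
    exact ⟨a, b, hdisj ha, hb, hab⟩

/-! ### Topological properties of the space. -/

theorem semiregularSpace (hD : ExtO D) : SemiregularSpace (EFilter D) :=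
  ⟨_, isTopologicalBasis_basicSet, Set.forall_mem_range.2 (isRegularOpenSet_basicSet hD)⟩

theorem weaklyRegularSpace (hD : ExtO D) (h : ExtDC D) : WeaklyRegularSpace (EFilter D) := by
  refine ⟨semiregularSpace hD, fun U hU ⟨Γ, hΓ⟩ => ?_⟩
  obtain ⟨a, ha, haU⟩ := exists_basicSet_subset hU hΓ
  obtain ⟨b, hb, hab⟩ := h a (basicSet_nonempty_iff.1 ⟨Γ, ha⟩)
  -- The closure of this set is the complement of `basicSet b`, and `basicSet a` covers that
  -- complement.
  refine ⟨((toRegOpens hD b)ᶜ).carrier, RegOpens.isOpen_carrier _,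
    RegOpens.carrier_nonempty fun h' => hb ?_, ?_⟩
  · rw [compl_eq_bot] at h'
    have h' : basicSet b = Set.univ := congrArg RegOpens.carrier h'
    rw [← basicSet_top] at h'
    exact top_le_iff.1 (basicSet_subset_iff.1 h'.superset)
  · rw [RegOpens.closure_carrier_compl]
    exact fun Δ hΔ => haU ((mem_or_mem_of_not_dc hab Δ).resolve_right hΔ)

/-- A clopen set and its complement are regular open, hence contain covering basic sets, which are
disjoint; (Con Ĉ) forces one to be everything. Nonemptiness is not claimed: if ⊥ = ⊤ there are no
E-filters. -/
theorem preconnectedSpace (hD : ExtO D) (h : ConDC D) : PreconnectedSpace (EFilter D) := by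
  refine preconnectedSpace_iff_clopen.2 fun U hU => ?_
  obtain ⟨a, b, ha, hb, hab⟩ := exists_basicSet_subset_of_cover hD hU.isRegularOpenSet
    hU.compl.isRegularOpenSet fun Γ => em _
  have hdisj : a ⊓ b = ⊥ := by
    by_contra hne
    obtain ⟨Γ, hΓ⟩ := basicSet_nonempty_iff.2 hne
    rw [basicSet_inf] at hΓ
    exact hb hΓ.2 (ha hΓ.1)
  by_cases ha1 : a = ⊤
  · rw [ha1, basicSet_top] at ha
    exact Or.inr (Set.univ_subset_iff.1 ha)
  by_cases hb1 : b = ⊤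
  · rw [hb1, basicSet_top] at hb
    exact Or.inl (Set.compl_univ_iff.1 (Set.univ_subset_iff.1 hb))
  exact absurd (h a b ha1 hb1 hdisj) hab

theorem kappaNormalSpace (hD : ExtO D) (h : Nor2 D) : KappaNormalSpace (EFilter D) := by
  intro F G hF hG hFG
  obtain ⟨a, b, ha, hb, hab⟩ := exists_basicSet_subset_of_cover hD hF.compl hG.compl fun Γ => by
    by_contra! hΓ
    exact Set.disjoint_left.1 hFG (not_not.1 hΓ.1) (not_not.1 hΓ.2)
  obtain ⟨c, d, hcd, hac, hbd⟩ := h a b hab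
  -- F misses `basicSet a`, and the basic sets of a and c cover the space, so F lies in `basicSet
  -- c`; likewise for G.
  refine ⟨basicSet c, basicSet d, isOpen_basicSet c, isOpen_basicSet d,
    fun Γ hΓ => (mem_or_mem_of_not_dc hac Γ).resolve_left fun h => ha h hΓ,
    fun Γ hΓ => (mem_or_mem_of_not_dc hbd Γ).resolve_left fun h => hb h hΓ, ?_⟩
  rw [Set.disjoint_iff_inter_eq_empty, ← basicSet_inf, hcd, basicSet_bot]

end EFilter

theorem mainTheorem11 {D : Type*} [DistribLattice D] [BoundedOrder D] [EDCLattice D]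
    (hD : EDCLattice.IsORich D) :
    CompactSpace (EFilter D) ∧
    SemiregularSpace (EFilter D) ∧
    (∃ h : BoundedLatticeHom D (RegOpens (EFilter D)),
      (∀ a : D, (h a).carrier = {Γ : EFilter D | a ∈ Γ.carrier}) ∧
      EDCLattice.IsEmbedding h ∧
      EDCLattice.IsDense h ∧
      EDCLattice.IsDCSeparable h) ∧
    (EDCLattice.ExtDC D → WeaklyRegularSpace (EFilter D)) ∧
    (EDCLattice.ConDC D → PreconnectedSpace (EFilter D)) ∧
    (EDCLattice.Nor2 D → KappaNormalSpace (EFilter D)) :=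
  ⟨inferInstance, EFilter.semiregularSpace hD.extO,
    ⟨EFilter.toRegOpens hD.extO, EFilter.carrier_toRegOpens hD.extO,
      EFilter.isEmbedding_toRegOpens hD, EFilter.isDense_toRegOpens hD.extO,
      EFilter.isDCSeparable_toRegOpens hD⟩,
    EFilter.weaklyRegularSpace hD.extO, EFilter.preconnectedSpace hD.extO,
    EFilter.kappaNormalSpace hD.extO⟩
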